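/- Let $D$ be a division ring, finite dimensional over its center $F$, let $G=D^{\#}=D\setminus\{0\}$ be its multiplicative group, let $\nu$ be the reduced norm and $\mathbb O=\{a\in G:\nu(a)=1\}$. Let $N\trianglelefteq G$ be a normal subgroup with $F^{\#}\le N$ such that $G^*=G/N$ is finite and $[G^*,G^*]=G^*$ (for example, $G^*$ finite nonabelian simple). For $a\in D$ put $N(a)=\{n\in N: a+n\in N\}$. Let $\mathbb N\subsetneq N$ be a nonempty subset, invariant under conjugation by $G$, which satisfies the $U$-Hypothesis: with $\bar{\mathbb N}=N\setminus\mathbb N$, (U1) $1,-1\in\mathbb N$; (U2) $\mathbb N\mathbb N=\mathbb N$; (U3) $\bar n+1\in\mathbb N$ and $\bar n-1\in N$ for all $\bar n\in\bar{\mathbb N}$. Put $$U=\{n\in\mathbb N: n^{-1}\in\mathbb N\},\qquad \mathbb M=\mathbb N\setminus U,\qquad \hat K=\{a\in\mathbb OU\setminus N:\mathbb M\subseteq N(a)\},$$ $$R=\{x\in D: x=0\text{ or }\mathbb M\subseteq N(x)\},\qquad I=\{r\in R: r=0\text{ or }U\subseteq N(r)\}.$$ Assume that $\hat K=\mathbb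 OU\setminus N$. Then: 1. $R\cap N=U\cup\bar{\mathbb N}$, and $R\cap(G\setminus N)=\{nk: n\in U\cup\bar{\mathbb N},\ k\in\hat K\}$. 2. $R$ is a subring of $D$, and it is a local ring. $I$ is a two-sided ideal of $R$; it is the unique maximal left ideal, the unique maximal right ideal and the unique maximal two-sided ideal of $R$. 3. $R\setminus I=\mathbb OU$, and this is the group of units of $R$. 4. $R/I$ is a division ring. The homomorphism $\psi:\mathbb OU\to(R/I)^{\#}$ induced by $R\to R/I$ is surjective, and $\ker\psi\le U$. There is a surjective homomorphism $\pi:(R/I)^{\#}\to G^*$ with $\pi(\psi(a))=Na$ for all $a\in\mathbb OU$. 5. If $G^*\neq 1$, then $R/I$ is infinite. 6. For $x^*\in G^*\setminus\{1^*\}$ let $\mathbb N_{x^*}$ be the set of all $n\in N$ such that $n\in N(a)$ for every $a\in G$ with $Na=x^*$ and $1\in N(a)$; for a conjugacy class $C^*\subseteq G^*\setminus\{1^*\}$ let $\mathbb N_{C^*}=\bigcap_{y^*\in C^*}\mathbb N_{y^*}$. Then $\mathbb N\neq\mathbb N_{C^*}$ for every conjugacy class $C^*\subseteq G^*\setminus\{1^*\}$.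 That is, if $\mathbb N$ is one of the sets $\mathbb N_{C^*}$, the assumptions above are contradictory. -/

import Mathlib

open scoped TensorProduct Pointwise

section ReducedNorm

variable {F D K : Type*} [Field F] [DivisionRing D] [Algebra F D] [Field K] [Algebra F K]

theorem coord_mul_right {ι : Type*} [DecidableEq ι] (b : Module.Basis ι F K)
    (x : K ⊗[F] D) (d : D) (i : ι) :
    TensorProduct.equivFinsuppOfBasisLeft b (x * (1 ⊗ₜ[F] d)) i =
      TensorProduct.equivFinsuppOfBasisLeft b x i * d := by
  induction x with
  | zero => simp
  | tmul k e => simp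
  | add x y hx hy => simp [add_mul, hx, hy]

theorem coord_mul_left {ι : Type*} [DecidableEq ι] (b : Module.Basis ι F K)
    (x : K ⊗[F] D) (d : D) (i : ι) :
    TensorProduct.equivFinsuppOfBasisLeft b ((1 ⊗ₜ[F] d) * x) i =
      d * TensorProduct.equivFinsuppOfBasisLeft b x i := by
  induction x with
  | zero => simp
  | tmul k e => simp
  | add x y hx hy => simp [mul_add, hx, hy]

theorem isSimpleRing_scalarExtension [Algebra.IsCentral F D] : IsSimpleRing (K ⊗[F] D) := by
  classical
  have : Nontrivial (K ⊗[F] D) := inferInstance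
  refine ⟨⟨fun I => or_iff_not_imp_left.2 fun hI => ?_⟩⟩
  let b := Module.Basis.ofVectorSpace F K
  let φ := TensorProduct.equivFinsuppOfBasisLeft (N := D) b
  have hne : ∃ n : ℕ, ∃ x ∈ I, x ≠ 0 ∧ (φ x).support.card = n := by
    by_contra! h
    exact hI (TwoSidedIdeal.ext fun x => ⟨fun hx => by
      by_contra hx0
      exact h _ x hx (by simpa using hx0) rfl, fun hx => by
      rw [TwoSidedIdeal.mem_bot] at hx; rw [hx]; exact I.zero_mem⟩)
  obtain ⟨x, hxI, hx0, hxn⟩ := Nat.find_spec hne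
  have hmin : ∀ y ∈ I, (φ y).support.card < (φ x).support.card → y = 0 := by
    intro y hy hlt
    by_contra hy0
    exact Nat.find_min hne (hxn ▸ hlt) ⟨y, hy, hy0, rfl⟩
  have hφx : φ x ≠ 0 := by simpa using hx0
  obtain ⟨j, hj⟩ := Finsupp.ne_iff.1 hφx
  rw [Finsupp.zero_apply] at hj
  set z := x * (1 ⊗ₜ[F] (φ x j)⁻¹) with hz
  have hzI : z ∈ I := I.mul_mem_right _ _ hxI
  have hzc : ∀ i, φ z i = φ x i * (φ x j)⁻¹ := fun i => coord_mul_right b x _ i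
  have hcomm : ∀ d : D, (1 ⊗ₜ[F] d) * z - z * (1 ⊗ₜ[F] d) = 0 := by
    intro d
    refine hmin _ (I.sub_mem (I.mul_mem_left _ _ hzI) (I.mul_mem_right _ _ hzI)) ?_
    have hc : ∀ i, φ ((1 ⊗ₜ[F] d) * z - z * (1 ⊗ₜ[F] d)) i = d * φ z i - φ z i * d := by
      intro i
      rw [map_sub, Finsupp.sub_apply]
      exact congrArg₂ _ (coord_mul_left b z d i) (coord_mul_right b z d i)
    refine Finset.card_lt_card ((Finset.ssubset_iff_of_subset fun i hi => ?_).2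
      ⟨j, Finsupp.mem_support_iff.2 hj, ?_⟩)
    · rw [Finsupp.mem_support_iff] at hi ⊢
      intro h0
      exact hi (by rw [hc, hzc, h0]; simp)
    · rw [Finsupp.mem_support_iff, not_not, hc, hzc, mul_inv_cancel₀ hj]; simp
  have hcen : ∀ i, ∃ f : F, φ z i = algebraMap F D f := by
    intro i
    refine (Algebra.IsCentral.mem_center_iff F).1 (Subalgebra.mem_center_iff.2 fun d => ?_)
    have h1 := congrArg (fun w => φ w i) (sub_eq_zero.1 (hcomm d))
    exact (coord_mul_left b z d i).symm.trans (h1.trans (coord_mul_right b z d i))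
  choose f hf using hcen
  have hzk : z = (∑ i ∈ (φ z).support, f i • b i) ⊗ₜ[F] (1 : D) := by
    apply φ.injective
    ext i
    rw [TensorProduct.equivFinsuppOfBasisLeft_apply_tmul_apply]
    simp only [map_sum, map_smul, Module.Basis.repr_self, Finsupp.coe_finsetSum, Finset.sum_apply,
      Finsupp.smul_apply, Finsupp.single_apply, smul_eq_mul, mul_ite, mul_one, mul_zero,
      Finset.sum_ite_eq']
    split_ifs with h
    · rw [hf i, Algebra.algebraMap_eq_smul_one]
    · rw [zero_smul]; exact Finsupp.notMem_support_iff.1 h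
  set k := ∑ i ∈ (φ z).support, f i • b i with hk
  have hz0 : z ≠ 0 := by
    intro h0
    have := hzc j
    rw [h0, map_zero, mul_inv_cancel₀ hj] at this
    exact zero_ne_one this
  have hk0 : k ≠ 0 := by
    intro h0
    exact hz0 (by rw [hzk, h0, TensorProduct.zero_tmul])
  have h1 : (1 : K ⊗[F] D) ∈ I := by
    have := I.mul_mem_left (k⁻¹ ⊗ₜ[F] (1 : D)) z hzI
    rwa [hzk, Algebra.TensorProduct.tmul_mul_tmul, inv_mul_cancel₀ hk0, one_mul,
      ← Algebra.TensorProduct.one_def] at this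
  exact TwoSidedIdeal.ext fun y => ⟨fun _ => trivial, fun _ => by
    simpa using I.mul_mem_left y 1 h1⟩
end ReducedNorm

section Splitting

variable (F D : Type*) [Field F] [DivisionRing D] [Algebra F D] [Algebra.IsCentral F D]
  [FiniteDimensional F D]

theorem exists_splitting : ∃ n : ℕ, Nonempty
    (AlgebraicClosure F ⊗[F] D ≃ₐ[AlgebraicClosure F]
      Matrix (Fin n) (Fin n) (AlgebraicClosure F)) := by
  have : IsSimpleRing (AlgebraicClosure F ⊗[F] D) := isSimpleRing_scalarExtension
  obtain ⟨n, _, h⟩ := IsSimpleRing.exists_algEquiv_matrix_of_isAlgClosed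
    (AlgebraicClosure F) (AlgebraicClosure F ⊗[F] D)
  exact ⟨n, h⟩

/-- The degree of the central division algebra `D` over `F`. -/
noncomputable def degree : ℕ := (exists_splitting F D).choose

/-- A splitting of `D` over the algebraic closure of its centre `F`. -/
noncomputable def splitting : AlgebraicClosure F ⊗[F] D ≃ₐ[AlgebraicClosure F]
    Matrix (Fin (degree F D)) (Fin (degree F D)) (AlgebraicClosure F) :=
  (exists_splitting F D).choose_spec.some

/-- The reduced norm `a ↦ det (splitting (1 ⊗ a))`. By Skolem-Noether it does not depend on the
splitting; its values lie in the subfield `F` of the algebraic closure. -/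
noncomputable def reducedNorm : D →* AlgebraicClosure F :=
  Matrix.detMonoidHom.comp
    ((splitting F D).toRingEquiv.toRingHom.toMonoidHom.comp
      (Algebra.TensorProduct.includeRight :
        D →ₐ[F] AlgebraicClosure F ⊗[F] D).toRingHom.toMonoidHom)

theorem reducedNorm_apply (a : D) :
    reducedNorm F D a = (splitting F D (1 ⊗ₜ[F] a)).det := rfl

/-- The group of elements of reduced norm one. -/
noncomputable def normOne : Subgroup Dˣ := (Units.map (reducedNorm F D)).ker

end Splitting

section Sets

variable {D : Type*} [DivisionRing D]

/-- `N(a) = {n ∈ N : a + n ∈ N}`. -/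
def nbhd (N : Subgroup Dˣ) (a : D) : Set Dˣ :=
  {n | n ∈ N ∧ ∃ m ∈ N, (m : D) = a + n}

/-- The `U`-Hypothesis with respect to the set `S` (where the complement of `S` is taken
in `N`). -/
structure UHypothesis (N : Subgroup Dˣ) (S : Set Dˣ) : Prop where
  nonempty : S.Nonempty
  ssubset : S ⊂ (N : Set Dˣ)
  normal : ∀ g : Dˣ, ∀ n ∈ S, g⁻¹ * n * g ∈ S
  one_mem : 1 ∈ S
  neg_one_mem : -1 ∈ S
  mul_self : S * S = S
  add_one : ∀ n ∈ (N : Set Dˣ) \ S, ∃ m ∈ S, (m : D) = n + 1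
  sub_one : ∀ n ∈ (N : Set Dˣ) \ S, ∃ m ∈ N, (m : D) = n - 1

/-- `U = {n ∈ S : n⁻¹ ∈ S}`. -/
def unitPart (S : Set Dˣ) : Set Dˣ := {n | n ∈ S ∧ n⁻¹ ∈ S}

/-- `M = S \ U`. -/
def nonunitPart (S : Set Dˣ) : Set Dˣ := S \ unitPart S

/-- `OU`, where `O` is the group of elements of reduced norm one. -/
def normOneMul (F : Type*) [Field F] [Algebra F D] [Algebra.IsCentral F D]
    [FiniteDimensional F D] (S : Set Dˣ) : Set Dˣ :=
  (normOne F D : Set Dˣ) * unitPart S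

/-- `K̂ = {a ∈ OU \ N : M ⊆ N(a)}`. -/
def kHat (F : Type*) [Field F] [Algebra F D] [Algebra.IsCentral F D]
    [FiniteDimensional F D] (N : Subgroup Dˣ) (S : Set Dˣ) : Set Dˣ :=
  {a | a ∈ normOneMul F S \ (N : Set Dˣ) ∧ nonunitPart S ⊆ nbhd N (a : D)}

/-- `R = {x ∈ D : x = 0 or M ⊆ N(x)}`. -/
def ringSet (N : Subgroup Dˣ) (S : Set Dˣ) : Set D :=
  {x | x = 0 ∨ nonunitPart S ⊆ nbhd N x}

/-- `I = {r ∈ R : r = 0 or U ⊆ N(r)}`. -/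
def idealSet (N : Subgroup Dˣ) (S : Set Dˣ) : Set D :=
  {r | r ∈ ringSet N S ∧ (r = 0 ∨ unitPart S ⊆ nbhd N r)}

/-- `P_x = {a ∈ Nx : 1 ∈ N(a)}` for an element `x` of `G* = Dˣ ⧸ N`. -/
def pSet (N : Subgroup Dˣ) [N.Normal] (x : Dˣ ⧸ N) : Set Dˣ :=
  {a | (a : Dˣ ⧸ N) = x ∧ 1 ∈ nbhd N (a : D)}

/-- `N_x = {n ∈ N : n ∈ N(a) for all a ∈ P_x}`. -/
def nSet (N : Subgroup Dˣ) [N.Normal] (x : Dˣ ⧸ N) : Set Dˣ :=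
  {n | n ∈ N ∧ ∀ a ∈ pSet N x, n ∈ nbhd N (a : D)}

/-- `N_C`, the intersection of the sets `N_y` with `y` in the conjugacy class `C` of `x`. -/
def nSetClass (N : Subgroup Dˣ) [N.Normal] (x : Dˣ ⧸ N) : Set Dˣ :=
  {n | ∀ y : Dˣ ⧸ N, IsConj x y → n ∈ nSet N y}

end Sets

/-! The set `S` encodes a valuation on N. With B = N \ S, read B as the elements of positive value
and U as those of value zero. The `U`-Hypothesis makes N the disjoint union of U, B and B⁻¹, and
gives 1 + B ⊆ U. This is a cone (`IsCone`) with value group N/U.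

Let H = OU. As O contains all commutators and G* is perfect, G = NH. Moreover H ∩ N = U: by
Wedderburn's factorization of the minimal polynomial, an element of reduced norm one in the
invariant semigroup B would force 1 ∈ B (`notMem_of_mem_normOne`). So G/H ≅ N/U, and the assumption
on K̂ yields 1 + BH ⊆ U. Thus the cone extends to G with BH as positive part (`IsCone.extend`). Then
R = {0} ∪ H ∪ BH is its valuation ring, I = {0} ∪ BH its maximal ideal, and (R/I)^# is a quotient of
H that maps onto H/U ≅ G*.

If G* ≠ 1, it is not abelian, so R/I is not commutative and hence infinite. A normal subgroup of
finite index in the multiplicative group of an infinite division ring has differences in every coset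
(`exists_sub_eq_of_finite`). Lifting such a difference from R/I gives a ∈ H of class x with 1 + a ∈
N. If `S` were N_C, then U ⊆ S ⊆ N(a). But k + U ⊆ N passes from k ∈ H \ N to its powers, one of
which lies in U, and this produces 0 ∈ U. -/

section Wedderburn

/-! ### Polynomials over a division ring and Wedderburn's factorization. -/

open Polynomial

theorem exists_eq_mul_X_sub_C_add {A : Type*} [Ring A] (p : A[X]) (a : A) :
    ∃ q : A[X], p = q * (X - C a) + C (p.eval a) := by
  induction p using Polynomial.induction_on' with
  | add p q hp hq =>
    obtain ⟨p', hp⟩ := hp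
    obtain ⟨q', hq⟩ := hq
    refine ⟨p' + q', ?_⟩
    conv_lhs => rw [hp, hq]
    rw [eval_add, C_add]
    noncomm_ring
  | monomial n c =>
    refine ⟨C c * ∑ i ∈ Finset.range n, X ^ i * C a ^ (n - 1 - i), ?_⟩
    rw [mul_assoc, (commute_X (C a)).geom_sum₂_mul, eval_monomial, ← C_mul_X_pow_eq_monomial,
      mul_sub, C_mul, C_pow, sub_add_cancel]

variable {D : Type*} [DivisionRing D]

/-- Evaluation keeps coefficients on the left, so it is not multiplicative; moving h(b) past the
powers of b costs a conjugation. -/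
theorem eval_mul_conj (g h : D[X]) (b : D) (hb : h.eval b ≠ 0) :
    (g * h).eval b = g.eval (h.eval b * b * (h.eval b)⁻¹) * h.eval b := by
  induction g using Polynomial.induction_on' with
  | add p q hp hq => rw [add_mul, eval_add, eval_add, add_mul, hp, hq]
  | monomial n c =>
    rw [← C_mul_X_pow_eq_monomial, mul_assoc, eval_C_mul, X_pow_mul, eval_mul_X_pow, eval_C_mul,
      eval_X_pow,
      (show (h.eval b * b * (h.eval b)⁻¹) ^ n = h.eval b * b ^ n * (h.eval b)⁻¹ from
        Units.conj_pow (Units.mk0 _ hb) b n), mul_assoc, inv_mul_cancel_right₀ hb]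

variable {F : Type*} [Field F] [Algebra F D]

/-- If h has central coefficients, it comes from F and the minimal polynomial applies. Otherwise
some commutator dh - hd is nonzero of smaller degree and still vanishes on the conjugacy class of a.
-/
theorem natDegree_minpoly_le_of_eval_conj [Algebra.IsCentral F D] (a : D) :
    ∀ n : ℕ, ∀ h : D[X], h.Monic → h.natDegree = n →
      (∀ g : Dˣ, h.eval (g * a * ((g⁻¹ : Dˣ) : D)) = 0) → (minpoly F a).natDegree ≤ n := by
  intro n
  induction n using Nat.strong_induction_on with
  | _ n ih =>
    intro h hm hn hz
    by_cases hc : ∀ d : D, C d * h - h * C d = 0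
    · have hcen : ∀ i, ∃ f : F, algebraMap F D f = h.coeff i := by
        intro i
        obtain ⟨f, hf⟩ := (Algebra.IsCentral.mem_center_iff F).1
          (Subalgebra.mem_center_iff.2 fun d => by
            have := congrArg (fun p => coeff p i) (sub_eq_zero.1 (hc d))
            simpa using this)
        exact ⟨f, hf.symm⟩
      obtain ⟨q, hq, hdeg, hqm⟩ := lifts_and_natDegree_eq_and_monic
        ((lifts_iff_coeff_lifts h).2 hcen) hm
      rw [← hn, ← hdeg]
      refine natDegree_le_natDegree (minpoly.min F a hqm ?_)
      rw [← eval_map_algebraMap, hq]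
      simpa using hz 1
    · push Not at hc
      obtain ⟨d, hd⟩ := hc
      set p := C d * h - h * C d with hp
      have hd0 : d ≠ 0 := by
        rintro rfl
        simp [hp] at hd
      have hlt : p.degree < h.degree := by
        have h1 : (C d * h).degree = h.degree := by
          rw [degree_mul, degree_C hd0, zero_add]
        have h2 : (h * C d).degree = h.degree := by
          rw [degree_mul, degree_C hd0, add_zero]
        rw [← h1]
        refine degree_sub_lt_left (h1.trans h2.symm) ?_ ?_
        · rw [← degree_ne_bot, h1, degree_ne_bot]
          exact hm.ne_zero
        · rw [leadingCoeff_mul, leadingCoeff_mul, hm.leadingCoeff, leadingCoeff_C, one_mul, mul_one]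
      have hlc : p.leadingCoeff ≠ 0 := leadingCoeff_ne_zero.2 hd
      have hmon : (C p.leadingCoeff⁻¹ * p).Monic := by
        rw [Monic, leadingCoeff_mul, leadingCoeff_C, inv_mul_cancel₀ hlc]
      have hnd : (C p.leadingCoeff⁻¹ * p).natDegree = p.natDegree :=
        natDegree_C_mul (inv_ne_zero hlc)
      have hpn : p.natDegree < n := hn ▸ natDegree_lt_natDegree hd hlt
      refine (ih _ hpn _ hmon hnd fun g => ?_).trans hpn.le
      rw [eval_C_mul, hp, eval_sub, eval_C_mul, hz g, eval_mul_conj, eval_C]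
      · have := hz (Units.mk0 d hd0 * g)
        simp only [Units.val_mul, mul_inv_rev, Units.val_inv_eq_inv_val, Units.val_mk0] at this ⊢
        simp only [mul_assoc] at this ⊢
        rw [this]
        simp
      · simpa using hd0

/-- Wedderburn's factorization theorem. -/
theorem exists_minpoly_map_eq_prod [Algebra.IsCentral F D] [FiniteDimensional F D] (a : D) :
    ∃ l : List D, (∀ b ∈ l, ∃ g : Dˣ, b = g * a * ((g⁻¹ : Dˣ) : D)) ∧
      (minpoly F a).map (algebraMap F D) = (l.map fun b => X - C b).prod := by
  have hint : IsIntegral F a := Algebra.IsIntegral.isIntegral a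
  set f := (minpoly F a).map (algebraMap F D) with hf
  have hfm : f.Monic := (minpoly.monic hint).map _
  have hfd : f.natDegree = (minpoly F a).natDegree := natDegree_map _
  have hprod : ∀ l : List D, (l.map fun b => X - C b).prod.Monic ∧
      (l.map fun b => X - C b).prod.natDegree = l.length := by
    intro l
    induction l with
    | nil => simp
    | cons b l ih =>
      rw [List.map_cons, List.prod_cons]
      refine ⟨(monic_X_sub_C b).mul ih.1, ?_⟩
      rw [(monic_X_sub_C b).natDegree_mul ih.1, ih.2, natDegree_X_sub_C, List.length_cons, add_comm]
  have hroot : ∀ g : Dˣ, f.eval (g * a * ((g⁻¹ : Dˣ) : D)) = 0 := by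
    intro g
    have h1 : f.eval a = 0 := by rw [hf, eval_map_algebraMap, minpoly.aeval]
    have h2 : f * C (g : D) = C (g : D) * f := by
      ext i
      rw [coeff_mul_C, coeff_C_mul, hf, coeff_map]
      exact Algebra.commutes _ _
    have h3 : (f * C (g : D)).eval a = 0 := by rw [h2, eval_C_mul, h1, mul_zero]
    rw [eval_mul_conj _ _ _ (by simp), eval_C] at h3
    simpa using h3
  -- Linear factors are split off on the right. While the product h found so far has degree below
  -- that of f, it is nonzero at some conjugate b of a; then f(b) = 0 forces q to vanish at h(b) b
  -- h(b)⁻¹, again a conjugate of a.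
  have key : ∀ k ≤ f.natDegree, ∃ l : List D, l.length = k ∧
      (∀ b ∈ l, ∃ g : Dˣ, b = g * a * ((g⁻¹ : Dˣ) : D)) ∧
      ∃ q : D[X], f = q * (l.map fun b => X - C b).prod := by
    intro k
    induction k with
    | zero => exact fun _ => ⟨[], rfl, by simp, f, by simp⟩
    | succ k ih =>
      intro hk
      obtain ⟨l, hl, hconj, q, hq⟩ := ih (by omega)
      have hex : ∃ g : Dˣ, (l.map fun b => X - C b).prod.eval (g * a * ((g⁻¹ : Dˣ) : D)) ≠ 0 := by
        by_contra! hcon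
        have := natDegree_minpoly_le_of_eval_conj (F := F) a _ _ (hprod l).1 (hprod l).2 hcon
        omega
      obtain ⟨g, hg⟩ := hex
      set h := (l.map fun b => X - C b).prod with hh
      set c := h.eval (g * a * ((g⁻¹ : Dˣ) : D)) with hc
      have h0 := hroot g
      rw [hq, eval_mul_conj _ _ _ hg, ← hc] at h0
      obtain ⟨q', hq'⟩ := exists_eq_mul_X_sub_C_add q (c * (g * a * ((g⁻¹ : Dˣ) : D)) * c⁻¹)
      rw [(mul_eq_zero.1 h0).resolve_right hg, C_0, add_zero] at hq'
      refine ⟨(c * (g * a * ((g⁻¹ : Dˣ) : D)) * c⁻¹) :: l, by simp [hl], ?_, q', ?_⟩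
      · intro b hb
        rcases List.mem_cons.1 hb with rfl | hb
        · exact ⟨Units.mk0 c hg * g, by simp [mul_assoc]⟩
        · exact hconj b hb
      · rw [List.map_cons, List.prod_cons, ← mul_assoc, ← hq', hq]
  obtain ⟨l, hl, hconj, q, hq⟩ := key _ le_rfl
  refine ⟨l, hconj, ?_⟩
  have hqm : q.Monic := Monic.of_mul_monic_right (hprod l).1 (hq ▸ hfm)
  have hd : f.natDegree = q.natDegree + l.length := by
    conv_lhs => rw [hq]
    rw [hqm.natDegree_mul (hprod l).1, (hprod l).2]
  have hq1 : q = 1 := hqm.natDegree_eq_zero.1 (by omega)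
  rw [hq, hq1, one_mul]

end Wedderburn

/-! ### Comparison of the reduced norm, the norm and the minimal polynomial. -/

section Norm

/-- Left multiplication by A acts on each column separately, so its matrix is the Kronecker product
of A with the identity. -/
theorem norm_matrix {K n : Type*} [Field K] [Fintype n] [DecidableEq n] (A : Matrix n n K) :
    Algebra.norm K A = A.det ^ Fintype.card n := by
  have h : Algebra.leftMulMatrix (Matrix.stdBasis K n n) A =
      Matrix.kroneckerMap (· * ·) A (1 : Matrix n n K) := by
    ext ⟨i, j⟩ ⟨k, l⟩
    rw [Algebra.leftMulMatrix_eq_repr_mul, Matrix.stdBasis_eq_single, Matrix.kroneckerMap_apply]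
    change (A * Matrix.single k l (1 : K) : Matrix n n K) i j = _
    by_cases hjl : j = l
    · subst hjl
      simp
    · rw [Matrix.mul_single_apply_of_ne _ _ _ _ _ hjl, Matrix.one_apply_ne hjl, mul_zero]
  rw [Algebra.norm_eq_matrix_det (Matrix.stdBasis K n n), h]
  exact (Matrix.det_kronecker A 1).trans (by simp)

variable (F D : Type*) [Field F] [DivisionRing D] [Algebra F D] [Algebra.IsCentral F D]
  [FiniteDimensional F D]

theorem reducedNorm_pow_degree (a : D) :
    reducedNorm F D a ^ degree F D = algebraMap F (AlgebraicClosure F) (Algebra.norm F a) := by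
  rw [reducedNorm_apply, Algebra.norm_apply, ← LinearMap.det_baseChange]
  have h1 : (Algebra.lmul F D a).baseChange (AlgebraicClosure F) =
      Algebra.lmul (AlgebraicClosure F) (AlgebraicClosure F ⊗[F] D) (1 ⊗ₜ a) := by
    ext; simp
  rw [h1, ← Algebra.norm_apply, ← Algebra.norm_eq_of_algEquiv (splitting F D), norm_matrix,
    Fintype.card_fin]

/-- D is a vector space over F(a), on which left multiplication by a is a scalar; m is its
dimension. -/
theorem norm_eq_pow_coeff_zero_minpoly {F D : Type*} [Field F] [DivisionRing D] [Algebra F D]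
    [FiniteDimensional F D] (a : D) : ∃ m k : ℕ, m ≠ 0 ∧
    Algebra.norm F a = ((-1) ^ k * (minpoly F a).coeff 0) ^ m := by
  have hint : IsIntegral F a := Algebra.IsIntegral.isIntegral a
  have : Fact (Irreducible (minpoly F a)) := ⟨minpoly.irreducible hint⟩
  let φ : AdjoinRoot (minpoly F a) →ₐ[F] D :=
    Ideal.Quotient.liftₐ _ (Polynomial.aeval a) fun p hp => by
      obtain ⟨q, rfl⟩ := Ideal.mem_span_singleton'.1 hp
      rw [map_mul, minpoly.aeval, mul_zero]
  let _ : Module (AdjoinRoot (minpoly F a)) D := Module.compHom D (φ : _ →+* D)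
  have : IsScalarTower F (AdjoinRoot (minpoly F a)) D :=
    ⟨fun c x d => by
      change φ (c • x) * d = c • (φ x * d)
      rw [map_smul, smul_mul_assoc]⟩
  have : Module.Finite (AdjoinRoot (minpoly F a)) D := Module.Finite.of_restrictScalars_finite F _ D
  have h1 : Algebra.lmul F D a = (AdjoinRoot.root (minpoly F a) •
      (LinearMap.id : D →ₗ[AdjoinRoot (minpoly F a)] D)).restrictScalars F := by
    ext d
    change a * d = φ (AdjoinRoot.root (minpoly F a)) * d
    rw [show φ (AdjoinRoot.root (minpoly F a)) = a from Polynomial.aeval_X a]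
  have hne : minpoly F a ≠ 0 := minpoly.ne_zero hint
  have h2 := Algebra.PowerBasis.norm_gen_eq_coeff_zero_minpoly (AdjoinRoot.powerBasis hne)
  rw [AdjoinRoot.powerBasis_gen, AdjoinRoot.minpoly_root hne, (minpoly.monic hint).leadingCoeff,
    inv_one, Polynomial.C_1, mul_one] at h2
  exact ⟨Module.finrank (AdjoinRoot (minpoly F a)) D, _,
    Module.finrank_pos.ne', by
    rw [Algebra.norm_apply, h1, LinearMap.det_restrictScalars, LinearMap.det_smul, LinearMap.det_id,
      mul_one, map_pow, h2]⟩

end Norm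

/-! ### Elements of reduced norm one and invariant semigroups. -/

section NormOne

/-- An element of reduced norm one has a power of a product of conjugates equal to `± 1`, so it
cannot lie in an invariant subsemigroup disjoint from `{1, -1}`. -/
theorem notMem_of_mem_normOne {F D : Type*} [Field F] [DivisionRing D] [Algebra F D]
    [Algebra.IsCentral F D] [FiniteDimensional F D] {M : Set Dˣ}
    (hmul : ∀ a ∈ M, ∀ b ∈ M, a * b ∈ M) (hneg : ∀ a ∈ M, -a ∈ M)
    (hconj : ∀ g : Dˣ, ∀ a ∈ M, g * a * g⁻¹ ∈ M) (h1 : 1 ∉ M) {a : Dˣ}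
    (ha : a ∈ normOne F D) : a ∉ M := by
  intro haM
  have hν : reducedNorm F D a = 1 := congrArg Units.val (MonoidHom.mem_ker.1 ha)
  have hN : Algebra.norm F (a : D) = 1 := by
    have := reducedNorm_pow_degree F D (a : D)
    rw [hν, one_pow] at this
    exact (algebraMap F (AlgebraicClosure F)).injective (by rw [← this, map_one])
  obtain ⟨m, k, hm0, hm⟩ := norm_eq_pow_coeff_zero_minpoly (F := F) (a : D)
  obtain ⟨l, hl, hf⟩ := exists_minpoly_map_eq_prod (F := F) (a : D)
  -- The constant coefficient is the product of the -b. The empty list is excluded because 1 ∉ M.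
  have hprod : ∀ l : List D, (∀ b ∈ l, ∃ g : Dˣ, b = g * a * ((g⁻¹ : Dˣ) : D)) → l ≠ [] →
      ∃ c ∈ M, (c : D) = (l.map fun b => Polynomial.X - Polynomial.C b).prod.coeff 0 := by
    intro l
    induction l with
    | nil => simp
    | cons b l ih =>
      intro hl _
      obtain ⟨g, hg⟩ := hl b (by simp)
      have hb := hneg _ (hconj g a haM)
      have hbv : ((-(g * a * g⁻¹) : Dˣ) : D) = -b := by rw [hg]; simp
      rw [List.map_cons, List.prod_cons, Polynomial.mul_coeff_zero]
      by_cases hnil : l = []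
      · exact ⟨_, hb, by simp [hbv, hnil]⟩
      · obtain ⟨c, hc, hcv⟩ := ih (fun b hb => hl b (by simp [hb])) hnil
        exact ⟨_, hmul _ hb _ hc, by rw [Units.val_mul, hbv, hcv]; simp⟩
  have hnil : l ≠ [] := by
    rintro rfl
    have h := congrArg Polynomial.natDegree hf
    rw [Polynomial.natDegree_map] at h
    have := minpoly.natDegree_pos (A := F) (x := (a : D)) (Algebra.IsIntegral.isIntegral _)
    simp at h
    omega
  obtain ⟨c, hc, hcv⟩ := hprod l hl hnil
  rw [← hf, Polynomial.coeff_map] at hcv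
  have hpow : ∀ n : ℕ, c ^ (n + 1) ∈ M := by
    intro n
    induction n with
    | zero => simpa using hc
    | succ n ih => rw [pow_succ]; exact hmul _ ih _ hc
  have hc2 : ((-1) ^ k * c) ^ m = 1 := by
    ext
    have := congrArg (algebraMap F D) (hm.symm.trans hN)
    simpa [hcv] using this
  -- Doubling the exponent removes the sign (-1)^k.
  have hc3 : c ^ (2 * m) = 1 := by
    rw [pow_mul]
    rcases neg_one_pow_eq_or Dˣ k with h | h <;> rw [h] at hc2
    · rw [one_mul] at hc2
      rw [← pow_mul, mul_comm, pow_mul, hc2, one_pow]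
    · rw [neg_one_mul] at hc2
      rw [← neg_sq, ← pow_mul, mul_comm, pow_mul, hc2, one_pow]
  have := hpow (2 * m - 1)
  rw [Nat.sub_add_cancel (by omega), hc3] at this
  exact h1 this

end NormOne

/-! ### Differences in subgroups of finite index. -/

section FiniteIndex

/-- Ramsey's theorem for pairs. A nonprincipal ultrafilter gives each x a colour shared by almost
all pairs (x, y); this colour is itself almost constant in x, and the sequence is built inside that
large set. -/
theorem exists_monochromatic_seq {α κ : Type*} [Infinite α] [Finite κ] (f : α → α → κ) :
    ∃ (c : κ) (s : ℕ → α), ∀ m n, m < n → s m ≠ s n ∧ f (s m) (s n) = c := by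
  let 𝓤 : Ultrafilter α := Filter.hyperfilter α
  have hx : ∀ x, ∃ c, ∀ᶠ y in 𝓤, f x y = c := by
    intro x
    obtain ⟨c, hc⟩ := Ultrafilter.eq_pure_of_finite (𝓤.map (f x))
    refine ⟨c, ?_⟩
    have : {c} ∈ 𝓤.map (f x) := by rw [hc]; exact Set.mem_singleton c
    exact this
  choose c hc using hx
  obtain ⟨c₀, hc₀⟩ := Ultrafilter.eq_pure_of_finite (𝓤.map c)
  have hc₁ : ∀ᶠ y in 𝓤, c y = c₀ := by
    have : {c₀} ∈ 𝓤.map c := by rw [hc₀]; exact Set.mem_singleton c₀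
    exact this
  obtain ⟨s, -, hs⟩ := exists_seq_of_forall_finset_exists (fun x => c x = c₀)
    (fun x y => x ≠ y ∧ f x y = c₀) fun t ht => by
      have h1 : ∀ᶠ y in 𝓤, ∀ x ∈ t, f x y = c x := (Filter.eventually_all_finset t).2 fun x _ => hc x
      have h2 : ∀ᶠ y in 𝓤, ∀ x ∈ t, x ≠ y := (Filter.eventually_all_finset t).2 fun x _ => by
        have : ({x}ᶜ : Set α) ∈ 𝓤 := Filter.compl_mem_hyperfilter_of_finite (Set.finite_singleton x)
        filter_upwards [this] with y hy
        exact fun h => hy h.symm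
      obtain ⟨y, hy, hy1, hy2⟩ := (hc₁.and (h1.and h2)).exists
      exact ⟨y, hy, fun x hx => ⟨hy2 x hx, (hy1 x hx).trans (ht x hx)⟩⟩
  exact ⟨c₀, s, hs⟩

/-- Finitely many sets, each having infinitely many pairwise disjoint translates, do not cover
an abelian group. -/
theorem exists_forall_notMem_of_disjoint_translates {ι A : Type*} [Finite ι] [AddCommGroup A]
    (S : ι → Set A) (d : ι → ℕ → A)
    (hd : ∀ i m n, m < n → ∀ x, x - d i m ∈ S i → x - d i n ∉ S i) : ∃ x, ∀ i, x ∉ S i := by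
  classical
  have := Fintype.ofFinite ι
  by_contra! hcov
  set k := Fintype.card ι + 1 with hk
  -- A grid of k^r points, r = |ι|. A line in direction i meets S i at most once, so covering the
  -- grid needs k^r ≤ r k^(r-1), which fails for k = r + 1.
  let p : (ι → Fin k) → A := fun t => -∑ i, d i (t i)
  choose c hc using fun t => hcov (p t)
  let φ : (ι → Fin k) → Σ i : ι, ({j // j ≠ i} → Fin k) := fun t => ⟨c t, fun j => t j⟩
  have hp : ∀ t i, p t = -(∑ j : {j // j ≠ i}, d j (t j)) - d i (t i) := by
    intro t i
    simp only [p]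
    rw [Fintype.sum_eq_add_sum_subtype_ne _ i]
    abel
  have hφ : Function.Injective φ := by
    intro t t' h
    have key : ∀ i, ∀ t t' : ι → Fin k, p t ∈ S i → p t' ∈ S i →
        (∀ j : {j // j ≠ i}, t j = t' j) → t i < t' i → False := by
      intro i t t' ht ht' hs hlt
      rw [hp t i] at ht
      rw [hp t' i] at ht'
      have : ∑ j : {j // j ≠ i}, d j (t j) = ∑ j : {j // j ≠ i}, d j (t' j) :=
        Finset.sum_congr rfl fun j _ => by rw [hs j]
      rw [← this] at ht'
      exact hd i _ _ hlt _ ht ht'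
    simp only [φ, Sigma.mk.injEq] at h
    obtain ⟨h1, h2⟩ := h
    have ht := hc t
    have ht' := hc t'
    rw [← h1] at ht'
    generalize c t = i at h1 h2 ht ht'
    subst h1
    have h2 := congrFun (eq_of_heq h2)
    funext j
    by_cases hj : j = c t'
    · subst hj
      rcases lt_trichotomy (t (c t')) (t' (c t')) with hlt | heq | hlt
      · exact (key _ _ _ ht ht' h2 hlt).elim
      · exact heq
      · exact (key _ _ _ ht' ht (fun j => (h2 j).symm) hlt).elim
    · exact h2 ⟨j, hj⟩
  have hcard := Fintype.card_le_of_injective φ hφ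
  obtain ⟨i₀, -⟩ := hcov 0
  have hpos : 0 < Fintype.card ι := Fintype.card_pos_iff.2 ⟨i₀⟩
  simp only [Fintype.card_sigma, Fintype.card_fun, Fintype.card_fin, Fintype.card_subtype_compl,
    Fintype.card_unique, Finset.sum_const, Finset.card_univ, smul_eq_mul] at hcard
  obtain ⟨n, hn⟩ : ∃ n, Fintype.card ι = n + 1 := ⟨Fintype.card ι - 1, by omega⟩
  rw [hn, Nat.add_sub_cancel, pow_succ, mul_comm] at hcard
  have : k ≤ n + 1 := Nat.le_of_mul_le_mul_right hcard (by positivity)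
  omega

/-- The differences of elements of a normal subgroup of finite index in the multiplicative group
of an infinite division ring meet every coset. -/
theorem exists_sub_eq_of_finite {Δ Q : Type*} [DivisionRing Δ] [Infinite Δ] [Group Q] [Finite Q]
    (π : Δˣ →* Q) (hπ : Function.Surjective π) (q : Q) :
    ∃ u v w : Δˣ, π u = 1 ∧ π v = 1 ∧ π w = q ∧ (u : Δ) - v = w := by
  classical
  obtain ⟨g, rfl⟩ := hπ q
  by_contra! hcon
  -- Pairs are coloured by the class of their difference; the default 1 is never used, as the terms
  -- of s are distinct.
  obtain ⟨c, s, hs⟩ := exists_monochromatic_seq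
    (fun x y : Δ => if h : x - y = 0 then 1 else π (Units.mk0 (x - y) h))
  obtain ⟨c, rfl⟩ := hπ c
  have hs1 : ∀ m n, m < n → ∃ w : Δˣ, π w = π c ∧ (w : Δ) = s m - s n := by
    intro m n hmn
    obtain ⟨h1, h2⟩ := hs m n hmn
    rw [dif_neg (sub_ne_zero.2 h1)] at h2
    exact ⟨_, h2, rfl⟩
  choose r hr using hπ
  -- The cosets together with {0} cover Δ. If two translates of coset j met, r_j g c⁻¹ (s_m - s_n)
  -- would be a difference within that coset; dividing by r_j gives a difference of kernel elements
  -- in the class of g.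
  obtain ⟨x, hx⟩ := exists_forall_notMem_of_disjoint_translates
    (ι := Option Q) (fun i => i.elim {0} fun j => {a : Δ | ∃ u : Δˣ, π u = j ∧ (u : Δ) = a})
    (fun i => i.elim s fun j n => (r j * g * c⁻¹ : Δˣ) * s n) (by
      rintro (_ | j) m n hmn x hx hx'
      · have h1 : x - s m = 0 := hx
        have h2 : x - s n = 0 := hx'
        exact (hs m n hmn).1 (by rw [← sub_eq_zero.1 h1, ← sub_eq_zero.1 h2])
      · obtain ⟨u, hu, hux⟩ := hx
        obtain ⟨v, hv, hvx⟩ := hx'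
        obtain ⟨w, hw, hws⟩ := hs1 m n hmn
        refine hcon ((r j)⁻¹ * v) ((r j)⁻¹ * u) (g * c⁻¹ * w) (by simp [hr, hv]) (by simp [hr, hu])
          (by simp [hw]) ?_
        simp only [Option.elim_some] at hux hvx
        simp only [Units.val_mul, hux, hvx, hws, ← mul_sub]
        rw [sub_sub_sub_cancel_left, ← mul_sub]
        simp [mul_assoc])
  rcases eq_or_ne x 0 with rfl | hx0
  · exact hx none rfl
  · exact hx (some (π (Units.mk0 x hx0))) ⟨_, rfl, rfl⟩

end FiniteIndex

/-! ### Cones and their valuation rings. -/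

section Cone

variable {D : Type*} [DivisionRing D]

/-- `C` plays the role of the elements of positive value, and `H` that of the elements of value
zero, for a valuation on the group `N` with values in the totally ordered group `N ⧸ H`. -/
structure IsCone (N H : Subgroup Dˣ) (C : Set Dˣ) : Prop where
  le : H ≤ N
  subset : C ⊆ N
  neg_one_mem : -1 ∈ H
  conj_mem : ∀ g : Dˣ, ∀ c ∈ C, g * c * g⁻¹ ∈ C
  mul_mem : ∀ c ∈ C, ∀ d ∈ C, c * d ∈ C
  mul_mem_left : ∀ h ∈ H, ∀ c ∈ C, h * c ∈ C
  one_notMem : 1 ∉ C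
  total : ∀ n ∈ N, n ∈ H ∨ n ∈ C ∨ n⁻¹ ∈ C
  one_add : ∀ c ∈ C, ∃ h ∈ H, (h : D) = 1 + c

namespace IsCone

variable {N H : Subgroup Dˣ} {C : Set Dˣ} (hC : IsCone N H C)
include hC

theorem mul_mem_right {c h : Dˣ} (hc : c ∈ C) (hh : h ∈ H) : c * h ∈ C := by
  have := hC.mul_mem_left h hh _ (hC.conj_mem h⁻¹ c hc)
  simpa [mul_assoc] using this

theorem notMem {h : Dˣ} (hh : h ∈ H) : h ∉ C := fun h' =>
  hC.one_notMem (by simpa using hC.mul_mem_left _ (H.inv_mem hh) _ h')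

theorem neg_mem {h : Dˣ} (hh : h ∈ H) : -h ∈ H := by
  simpa using H.mul_mem hC.neg_one_mem hh

theorem neg_mem_cone {c : Dˣ} (hc : c ∈ C) : -c ∈ C := by
  simpa using hC.mul_mem_left _ hC.neg_one_mem _ hc

theorem add_mem_of_mem {h c : Dˣ} (hh : h ∈ H) (hc : c ∈ C) : ∃ h' ∈ H, (h' : D) = h + c := by
  obtain ⟨u, hu, huv⟩ := hC.one_add _ (hC.mul_mem_left _ (H.inv_mem hh) _ hc)
  exact ⟨h * u, H.mul_mem hh hu, by rw [Units.val_mul, huv]; simp [mul_add]⟩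

theorem nonneg_mul {g g' : Dˣ} (hg : g ∈ (H : Set Dˣ) ∪ C) (hg' : g' ∈ (H : Set Dˣ) ∪ C) :
    g * g' ∈ (H : Set Dˣ) ∪ C := by
  rcases hg with hg | hg <;> rcases hg' with hg' | hg'
  · exact Or.inl (H.mul_mem hg hg')
  · exact Or.inr (hC.mul_mem_left _ hg _ hg')
  · exact Or.inr (hC.mul_mem_right hg hg')
  · exact Or.inr (hC.mul_mem _ hg _ hg')

theorem pos_mul {g g' : Dˣ} (hg : g ∈ C) (hg' : g' ∈ (H : Set Dˣ) ∪ C) : g * g' ∈ C := by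
  rcases hg' with hg' | hg'
  · exact hC.mul_mem_right hg hg'
  · exact hC.mul_mem _ hg _ hg'

theorem mul_pos {g g' : Dˣ} (hg : g ∈ (H : Set Dˣ) ∪ C) (hg' : g' ∈ C) : g * g' ∈ C := by
  rcases hg with hg | hg
  · exact hC.mul_mem_left _ hg _ hg'
  · exact hC.mul_mem _ hg _ hg'

end IsCone

namespace IsCone

variable {H : Subgroup Dˣ} {C : Set Dˣ} (hC : IsCone ⊤ H C)
include hC

/-- The ultrametric inequality. If t = (1 + g)⁻¹ were positive, tg would be positive too, yet tg = 1
- t lies in H. -/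
theorem one_add_nonneg {g : Dˣ} (hg : g ∈ (H : Set Dˣ) ∪ C) :
    1 + (g : D) = 0 ∨ ∃ g' ∈ (H : Set Dˣ) ∪ C, (g' : D) = 1 + g := by
  rcases eq_or_ne (1 + (g : D)) 0 with h0 | h0
  · exact Or.inl h0
  · refine Or.inr ⟨Units.mk0 _ h0, ?_, rfl⟩
    rcases hC.total (Units.mk0 _ h0) trivial with h | h | h
    · exact Or.inl h
    · exact Or.inr h
    · exfalso
      set t := (Units.mk0 _ h0)⁻¹ with ht
      have h1 := hC.pos_mul h hg
      obtain ⟨u, hu, huv⟩ := hC.one_add _ (hC.neg_mem_cone h)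
      have : u = t * g := by
        ext
        have h2 : (t : D) * (1 + g) = 1 := by rw [ht]; simp [h0]
        rw [huv, Units.val_mul, ← h2, mul_add]
        simp
      exact hC.notMem hu (this ▸ h1)

/-- The valuation ring of a cone. -/
def subring : Subring D where
  carrier := {x | x = 0 ∨ ∃ g ∈ (H : Set Dˣ) ∪ C, (g : D) = x}
  mul_mem' := by
    rintro _ _ (rfl | ⟨g, hg, rfl⟩) (rfl | ⟨g', hg', rfl⟩)
    · left; simp
    · left; simp
    · left; simp
    · exact Or.inr ⟨_, hC.nonneg_mul hg hg', rfl⟩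
  one_mem' := Or.inr ⟨1, Or.inl H.one_mem, rfl⟩
  zero_mem' := Or.inl rfl
  neg_mem' := by
    rintro _ (rfl | ⟨g, hg, rfl⟩)
    · left; simp
    · exact Or.inr ⟨-g, hg.imp hC.neg_mem hC.neg_mem_cone, by simp⟩
  add_mem' := by
    rintro _ _ (rfl | ⟨g, hg, rfl⟩) (rfl | ⟨g', hg', rfl⟩)
    · left; simp
    · right; exact ⟨g', hg', by simp⟩
    · right; exact ⟨g, hg, by simp⟩
    · have key : ∀ g ∈ (H : Set Dˣ) ∪ C, ∀ t ∈ (H : Set Dˣ) ∪ C,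
          (g : D) * (1 + t) = 0 ∨ ∃ g' ∈ (H : Set Dˣ) ∪ C, (g' : D) = g * (1 + t) := by
        intro g hg t ht
        rcases hC.one_add_nonneg ht with h | ⟨g', hg', h⟩
        · left; rw [h, mul_zero]
        · exact Or.inr ⟨_, hC.nonneg_mul hg hg', by rw [Units.val_mul, h]⟩
      -- The summand of smaller value is factored out.
      have h1 : (g : D) + g' = g * (1 + (g⁻¹ * g' : Dˣ)) := by simp [mul_add]
      have h2 : (g : D) + g' = g' * (1 + ((g⁻¹ * g')⁻¹ : Dˣ)) := by simp [mul_add, add_comm]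
      change (g : D) + g' = 0 ∨ ∃ a ∈ (H : Set Dˣ) ∪ C, (a : D) = g + g'
      rcases hC.total (g⁻¹ * g') trivial with h | h | h
      · rw [h1]; exact key _ hg _ (Or.inl h)
      · rw [h1]; exact key _ hg _ (Or.inr h)
      · rw [h2]; exact key _ hg' _ (Or.inr h)

theorem mem_subring {x : D} : x ∈ hC.subring ↔ x = 0 ∨ ∃ g ∈ (H : Set Dˣ) ∪ C, (g : D) = x :=
  Iff.rfl

theorem isUnit_iff {r : hC.subring} : IsUnit r ↔ ∃ h ∈ H, (h : D) = r := by
  constructor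
  · rintro ⟨u, rfl⟩
    have h1 : ((u : hC.subring) : D) * ((u⁻¹ : hC.subringˣ) : hC.subring) = 1 := by
      rw [← Subring.coe_mul, Units.mul_inv, Subring.coe_one]
    rcases hC.mem_subring.1 (u : hC.subring).2 with h | ⟨g, hg, hgu⟩
    · rw [h, zero_mul] at h1
      exact (zero_ne_one h1).elim
    rcases hC.mem_subring.1 ((u⁻¹ : hC.subringˣ) : hC.subring).2 with h | ⟨g', hg', hgu'⟩
    · rw [h, mul_zero] at h1
      exact (zero_ne_one h1).elim
    rcases hg with hg | hg
    · exact ⟨g, hg, hgu⟩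
    · rw [← hgu, ← hgu', ← Units.val_mul, Units.val_eq_one] at h1
      exact (hC.one_notMem (h1 ▸ hC.pos_mul hg hg')).elim
  · rintro ⟨h, hh, hr⟩
    refine ⟨⟨r, ⟨(h⁻¹ : Dˣ), Or.inr ⟨_, Or.inl (H.inv_mem hh), rfl⟩⟩, ?_, ?_⟩, rfl⟩
    · ext; simp [← hr]
    · ext; simp [← hr]

theorem mem_nonunits_iff {r : hC.subring} :
    r ∈ nonunits hC.subring ↔ (r : D) = 0 ∨ ∃ c ∈ C, (c : D) = r := by
  rw [_root_.mem_nonunits_iff, hC.isUnit_iff]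
  constructor
  · intro h
    rcases hC.mem_subring.1 r.2 with h0 | ⟨g, hg | hg, hgr⟩
    · exact Or.inl h0
    · exact (h ⟨g, hg, hgr⟩).elim
    · exact Or.inr ⟨g, hg, hgr⟩
  · rintro (h0 | ⟨c, hc, hcr⟩) ⟨h, hh, hhr⟩
    · exact h.ne_zero (hhr.trans h0)
    · rw [← hcr] at hhr
      exact hC.notMem hh (Units.ext hhr ▸ hc)

/-- The maximal ideal of the valuation ring of a cone. -/
def ideal : Ideal hC.subring where
  carrier := nonunits hC.subring
  zero_mem' := hC.mem_nonunits_iff.2 (Or.inl rfl)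
  smul_mem' := by
    rintro ⟨_, rfl | ⟨g, hg, rfl⟩⟩ y hy
    · exact hC.mem_nonunits_iff.2 (Or.inl (zero_mul _))
    · rcases hC.mem_nonunits_iff.1 hy with h | ⟨c, hc, h⟩
      · exact hC.mem_nonunits_iff.2 (Or.inl (by simp [h]))
      · exact hC.mem_nonunits_iff.2 (Or.inr ⟨g * c, hC.mul_pos hg hc, by simp [h]⟩)
  add_mem' := by
    intro a b ha hb
    have key : ∀ g ∈ C, ∀ t ∈ (H : Set Dˣ) ∪ C,
        (g : D) * (1 + t) = 0 ∨ ∃ g' ∈ C, (g' : D) = g * (1 + t) := by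
      intro g hg t ht
      rcases hC.one_add_nonneg ht with h | ⟨g', hg', h⟩
      · left; rw [h, mul_zero]
      · exact Or.inr ⟨_, hC.pos_mul hg hg', by rw [Units.val_mul, h]⟩
    rw [hC.mem_nonunits_iff] at ha hb ⊢
    rw [Subring.coe_add]
    rcases ha with ha | ⟨g, hg, ha⟩
    · rwa [ha, zero_add]
    rcases hb with hb | ⟨g', hg', hb⟩
    · rw [hb, add_zero]; exact Or.inr ⟨g, hg, ha⟩
    rw [← ha, ← hb]
    have h1 : (g : D) + g' = g * (1 + (g⁻¹ * g' : Dˣ)) := by simp [mul_add]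
    have h2 : (g : D) + g' = g' * (1 + ((g⁻¹ * g')⁻¹ : Dˣ)) := by simp [mul_add, add_comm]
    rcases hC.total (g⁻¹ * g') trivial with h | h | h
    · rw [h1]; exact key _ hg _ (Or.inl h)
    · rw [h1]; exact key _ hg _ (Or.inr h)
    · rw [h2]; exact key _ hg' _ (Or.inr h)

theorem mem_ideal {r : hC.subring} : r ∈ hC.ideal ↔ ¬ IsUnit r := Iff.rfl

theorem mem_ideal_iff {r : hC.subring} :
    r ∈ hC.ideal ↔ (r : D) = 0 ∨ ∃ c ∈ C, (c : D) = r := hC.mem_nonunits_iff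

theorem isTwoSided_ideal : hC.ideal.IsTwoSided where
  mul_mem_of_left := by
    rintro a ⟨_, rfl | ⟨g, hg, rfl⟩⟩ ha
    · exact hC.mem_ideal_iff.2 (Or.inl (mul_zero _))
    · rcases hC.mem_ideal_iff.1 ha with h | ⟨c, hc, h⟩
      · exact hC.mem_ideal_iff.2 (Or.inl (by simp [h]))
      · exact hC.mem_ideal_iff.2 (Or.inr ⟨c * g, hC.pos_mul hc hg, by simp [h]⟩)

theorem one_notMem_ideal : 1 ∉ hC.ideal := fun h => hC.mem_ideal.1 h isUnit_one

theorem isLocalRing : IsLocalRing hC.subring where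
  isUnit_or_isUnit_of_add_one {a b} h := by
    by_contra! hcon
    exact hC.one_notMem_ideal (h ▸ hC.ideal.add_mem hcon.1 hcon.2)

theorem isMaximal_iff (J : Ideal hC.subring) : J.IsMaximal ↔ J = hC.ideal := by
  have hle : ∀ J : Ideal hC.subring, J ≠ ⊤ → J ≤ hC.ideal := fun J hJ r hr hu =>
    hJ (J.eq_top_of_isUnit_mem hr hu)
  have htop : hC.ideal ≠ ⊤ := fun h => hC.one_notMem_ideal (h ▸ trivial)
  constructor
  · exact fun h => h.eq_of_le htop (hle J h.ne_top)
  · rintro rfl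
    exact ⟨htop, fun J hJ => by_contra fun h => hJ.not_ge (hle J h)⟩

theorem isCoatom_right_iff (J : Submodule (hC.subring)ᵐᵒᵖ hC.subring) :
    IsCoatom J ↔ (J : Set hC.subring) = hC.ideal := by
  have := hC.isTwoSided_ideal
  let I : Submodule (hC.subring)ᵐᵒᵖ hC.subring :=
    { carrier := hC.ideal
      zero_mem' := hC.ideal.zero_mem
      add_mem' := hC.ideal.add_mem
      smul_mem' := fun r _ hx => hC.ideal.mul_mem_right r.unop hx }
  have hle : ∀ J : Submodule (hC.subring)ᵐᵒᵖ hC.subring, J ≠ ⊤ → J ≤ I := by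
    rintro J hJ r hr ⟨u, rfl⟩
    refine hJ (Submodule.eq_top_iff'.2 fun x => ?_)
    have := J.smul_mem (MulOpposite.op (((u⁻¹ : hC.subringˣ) : hC.subring) * x)) hr
    simpa [← mul_assoc] using this
  have htop : I ≠ ⊤ := fun h => hC.one_notMem_ideal
    ((h ▸ Submodule.mem_top : (1 : hC.subring) ∈ I))
  have hI : IsCoatom I := ⟨htop, fun J hJ => by_contra fun h => hJ.not_ge (hle J h)⟩
  constructor
  · intro h
    rw [← (h.le_iff.1 (hle J h.1)).resolve_left htop]
    rfl
  · intro h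
    rwa [show J = I from SetLike.coe_injective h]

theorem isCoatom_twoSided_iff (J : TwoSidedIdeal hC.subring) :
    IsCoatom J ↔ (J : Set hC.subring) = hC.ideal := by
  have := hC.isTwoSided_ideal
  let I : TwoSidedIdeal hC.subring := hC.ideal.toTwoSided
  have hmem : ∀ r, r ∈ I ↔ r ∈ hC.ideal := fun r => Ideal.mem_toTwoSided
  have hle : ∀ J : TwoSidedIdeal hC.subring, J ≠ ⊤ → J ≤ I := by
    intro J hJ r hr
    rw [hmem]
    rintro ⟨u, rfl⟩
    refine hJ (TwoSidedIdeal.ext fun x => ⟨fun _ => trivial, fun _ => ?_⟩)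
    have := J.mul_mem_right _ (((u⁻¹ : hC.subringˣ) : hC.subring) * x) hr
    simpa [← mul_assoc] using this
  have htop : I ≠ ⊤ := fun h => hC.one_notMem_ideal ((hmem 1).1 (h ▸ trivial))
  have hI : IsCoatom I := ⟨htop, fun J hJ => by_contra fun h => hJ.not_ge (hle J h)⟩
  have hset : (I : Set hC.subring) = hC.ideal := Set.ext hmem
  constructor
  · intro h
    rw [← (h.le_iff.1 (hle J h.1)).resolve_left htop, hset]
  · intro h
    rwa [show J = I from SetLike.coe_injective (h.trans hset.symm)]

theorem nontrivial_quotient : Nontrivial (hC.subring ⧸ hC.ideal) :=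
  Ideal.Quotient.nontrivial_iff.2 fun h => hC.one_notMem_ideal (h ▸ trivial)

variable [hC.ideal.IsTwoSided]

/-- The ideal is the set of all nonunits, so every lift of a nonzero residue is a unit. -/
theorem exists_unit_of_quotient_ne_zero {q : hC.subring ⧸ hC.ideal} (hq : q ≠ 0) :
    ∃ r : hC.subringˣ, Ideal.Quotient.mk hC.ideal (r : hC.subring) = q := by
  obtain ⟨r, rfl⟩ := Ideal.Quotient.mk_surjective q
  by_contra hcon
  refine hq (Ideal.Quotient.eq_zero_iff_mem.2 fun hu => hcon ?_)
  obtain ⟨u, rfl⟩ := hu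
  exact ⟨u, rfl⟩

theorem isUnit_of_quotient_ne_zero {q : hC.subring ⧸ hC.ideal} (hq : q ≠ 0) : IsUnit q := by
  obtain ⟨r, rfl⟩ := hC.exists_unit_of_quotient_ne_zero hq
  exact r.isUnit.map _

theorem units_map_surjective :
    Function.Surjective (Units.map (Ideal.Quotient.mk hC.ideal : hC.subring →* hC.subring ⧸ hC.ideal)) := by
  have := hC.nontrivial_quotient
  intro q
  obtain ⟨r, hr⟩ := hC.exists_unit_of_quotient_ne_zero q.ne_zero
  exact ⟨r, Units.ext hr⟩

end IsCone

end Cone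

/-! ### Extending a cone from N to the whole group. -/

section Extension

variable {D : Type*} [DivisionRing D]

namespace IsCone

variable {N U : Subgroup Dˣ} {B : Set Dˣ} (hB : IsCone N U B)
include hB

/-- The values of v and u differ; factoring out the term of smaller value leaves an element of 1 + B
up to sign. -/
theorem sub_mem_of_notMem {v u : Dˣ} (hv : v ∈ N) (hvU : v ∉ U) (hu : u ∈ U) :
    ∃ n ∈ N, (n : D) = v - u := by
  rcases hB.total v hv with h | h | h
  · exact (hvU h).elim
  · obtain ⟨n, hn, hnv⟩ := hB.add_mem_of_mem (hB.neg_mem hu) h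
    exact ⟨n, hB.le hn, by rw [hnv, Units.val_neg]; abel⟩
  · obtain ⟨w, hw, hwv⟩ := hB.one_add _ (hB.neg_mem_cone (hB.mul_mem_right h hu))
    exact ⟨v * w, N.mul_mem hv (hB.le hw), by simp [hwv, mul_add, sub_eq_add_neg]⟩

theorem mem_of_eq_add {k v u : Dˣ} (hk : k ∉ N) (hv : v ∈ N) (hu : u ∈ U)
    (h : (v : D) = k + u) : v ∈ U := by
  by_contra hvU
  obtain ⟨n, hn, hnv⟩ := hB.sub_mem_of_notMem hv hvU hu
  refine hk ?_
  have : k = n := by ext; rw [hnv, h, add_sub_cancel_right]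
  exact this ▸ hn

/-- The set of all `x` with `x + U ⊆ U` contains all powers of any of its elements `k`. -/
theorem exists_add_notMem {k : Dˣ} (hk : k ∉ N) {j : ℕ} (hj : k ^ (j + 1) ∈ U) :
    ∃ u ∈ U, ∀ v ∈ N, (v : D) ≠ k + u := by
  by_contra! hcon
  have h1 : ∀ u ∈ U, ∃ v ∈ U, (v : D) = k + u := by
    intro u hu
    obtain ⟨v, hv, hvk⟩ := hcon u hu
    exact ⟨v, hB.mem_of_eq_add hk hv hu hvk, hvk⟩
  obtain ⟨w, hw, hwk⟩ := h1 1 U.one_mem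
  -- With w = k + 1 and a = k^(i+1) - u, the identity is k^(i+2) + u = (k^(i+1) - a w⁻¹) w. Taking u
  -- = -k^(j+1) at the end gives zero.
  have hpow : ∀ i : ℕ, ∀ u ∈ U, ∃ v ∈ U, (v : D) = (k : D) ^ (i + 1) + u := by
    intro i
    induction i with
    | zero => simpa using h1
    | succ i ih =>
      intro u hu
      obtain ⟨a, ha, hak⟩ := ih _ (hB.neg_mem hu)
      obtain ⟨b, hb, hbk⟩ := ih _ (U.mul_mem (hB.neg_mem ha) (U.inv_mem hw))
      refine ⟨b * w, U.mul_mem hb hw, ?_⟩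
      rw [Units.val_mul, hbk, add_mul, Units.val_mul, Units.inv_mul_cancel_right, Units.val_neg,
        hak, hwk, Units.val_neg, Units.val_one]
      noncomm_ring
  obtain ⟨v, -, hv⟩ := hpow j _ (hB.neg_mem hj)
  exact v.ne_zero (by rw [hv]; simp)

variable {H : Subgroup Dˣ} (hUH : U ≤ H) (hHU : ∀ h ∈ H, h ∈ N → h ∈ U)
  (hsup : ∀ g : Dˣ, ∃ n ∈ N, ∃ h ∈ H, n * h = g)
  (hadd : ∀ k ∈ H, k ∉ N → ∀ b ∈ B, ∃ m ∈ N, (m : D) = k + ((b⁻¹ : Dˣ) : D))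
include hHU

include hadd in
-- For h ∉ N, 1 + bh = b(h + b⁻¹) lies in N by `hadd`. As bh ∉ N, `mem_of_eq_add` puts this sum in
-- U.
theorem one_add_mul_mem {b h : Dˣ} (hb : b ∈ B) (hh : h ∈ H) :
    ∃ u ∈ U, (u : D) = 1 + (b * h : Dˣ) := by
  by_cases hN : h ∈ N
  · exact hB.one_add _ (hB.mul_mem_right hb (hHU _ hh hN))
  · obtain ⟨m, hm, hmk⟩ := hadd _ hh hN _ hb
    have h1 : ((b * m : Dˣ) : D) = (b * h : Dˣ) + (1 : Dˣ) := by
      rw [Units.val_mul, hmk, mul_add]; simp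
    have hbN : b ∈ N := hB.subset hb
    refine ⟨b * m, hB.mem_of_eq_add (fun h => hN ?_) (N.mul_mem hbN hm) U.one_mem h1, ?_⟩
    · exact (N.mul_mem_cancel_left hbN).1 h
    · rw [h1, add_comm, Units.val_one]

include hUH hsup hadd

/-- Extension of a cone from `N` to the whole multiplicative group. -/
theorem extend [H.Normal] : IsCone ⊤ H (B * (H : Set Dˣ)) where
  le := le_top
  subset := fun _ _ => trivial
  neg_one_mem := hUH hB.neg_one_mem
  conj_mem := by
    rintro g _ ⟨b, hb, h, hh, rfl⟩
    exact ⟨_, hB.conj_mem g b hb, _, Subgroup.Normal.conj_mem ‹_› h hh g, by group⟩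
  mul_mem := by
    rintro _ ⟨b, hb, h, hh, rfl⟩ _ ⟨b', hb', h', hh', rfl⟩
    exact ⟨_, hB.mul_mem _ hb _ (hB.conj_mem h b' hb'), _, H.mul_mem hh hh', by group⟩
  mul_mem_left := by
    rintro h hh _ ⟨b', hb', h', hh', rfl⟩
    exact ⟨_, hB.conj_mem h b' hb', _, H.mul_mem hh hh', by group⟩
  one_notMem := by
    rintro ⟨b, hb, h, hh, hbh⟩
    have : b = h⁻¹ := eq_inv_of_mul_eq_one_left hbh
    exact hB.notMem (hHU b (this ▸ H.inv_mem hh) (hB.subset hb)) hb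
  total := by
    intro g _
    obtain ⟨n, hn, h, hh, rfl⟩ := hsup g
    rcases hB.total n hn with hn | hn | hn
    · exact Or.inl (H.mul_mem (hUH hn) hh)
    · exact Or.inr (Or.inl ⟨n, hn, h, hh, rfl⟩)
    · exact Or.inr (Or.inr ⟨_, hB.conj_mem h⁻¹ _ hn, _, H.inv_mem hh, by group⟩)
  one_add := by
    rintro _ ⟨b, hb, h, hh, rfl⟩
    obtain ⟨u, hu, huv⟩ := hB.one_add_mul_mem hHU hadd hb hh
    exact ⟨u, hUH hu, huv⟩

end IsCone

end Extension

/-! ### The cone defined by the `U`-Hypothesis. -/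

namespace UHypothesis

variable {D : Type*} [DivisionRing D] {N : Subgroup Dˣ} {S : Set Dˣ} (hS : UHypothesis N S)
include hS

theorem mul_mem {a b : Dˣ} (ha : a ∈ S) (hb : b ∈ S) : a * b ∈ S :=
  hS.mul_self ▸ Set.mul_mem_mul ha hb

theorem conj_mem (g : Dˣ) {a : Dˣ} (ha : a ∈ S) : g * a * g⁻¹ ∈ S := by
  simpa using hS.normal g⁻¹ a ha

theorem inv_mul_mem_diff {s b : Dˣ} (hs : s ∈ S) (hb : b ∈ (N : Set Dˣ) \ S) :
    s⁻¹ * b ∈ (N : Set Dˣ) \ S :=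
  ⟨N.mul_mem (N.inv_mem (hS.ssubset.1 hs)) hb.1, fun h => hb.2 (by simpa using hS.mul_mem hs h)⟩

theorem neg_mem_diff {b : Dˣ} (hb : b ∈ (N : Set Dˣ) \ S) : -b ∈ (N : Set Dˣ) \ S := by
  have := hS.inv_mul_mem_diff hS.neg_one_mem hb
  rwa [inv_neg, inv_one, neg_one_mul] at this

/-- The subgroup `U` attached to a set satisfying the `U`-hypothesis. -/
def unitSubgroup : Subgroup Dˣ where
  carrier := unitPart S
  mul_mem' := fun ha hb => ⟨hS.mul_mem ha.1 hb.1, by rw [mul_inv_rev]; exact hS.mul_mem hb.2 ha.2⟩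
  one_mem' := ⟨hS.one_mem, by rw [inv_one]; exact hS.one_mem⟩
  inv_mem' := fun ha => ⟨ha.2, by rw [inv_inv]; exact ha.1⟩

/-- Let s = b + 1 ∈ S. If s⁻¹ ∉ S, then 1 - s⁻¹ ∈ S, and b = s(1 - s⁻¹) would lie in S. -/
theorem one_add_mem {b : Dˣ} (hb : b ∈ (N : Set Dˣ) \ S) : ∃ u ∈ unitPart S, (u : D) = 1 + b := by
  obtain ⟨s, hs, hsb⟩ := hS.add_one b hb
  refine ⟨s, ⟨hs, by_contra fun h => ?_⟩, by rw [hsb, add_comm]⟩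
  obtain ⟨t, ht, hts⟩ := hS.add_one _ (hS.neg_mem_diff ⟨N.inv_mem (hS.ssubset.1 hs), h⟩)
  refine hb.2 ?_
  have : b = s * t := by
    ext
    rw [Units.val_mul, hts, mul_add, Units.val_neg, mul_neg, Units.mul_inv, mul_one, hsb]
    abel
  exact this ▸ hS.mul_mem hs ht

/-- Otherwise 1 + n and 1 + n⁻¹ both lie in U, and so does their quotient n. -/
theorem mem_or_inv_mem {n : Dˣ} (hn : n ∈ N) : n ∈ S ∨ n⁻¹ ∈ S := by
  by_contra! hcon
  obtain ⟨u, hu, hun⟩ := hS.one_add_mem ⟨hn, hcon.1⟩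
  obtain ⟨w, hw, hwn⟩ := hS.one_add_mem ⟨N.inv_mem hn, hcon.2⟩
  have h1 : n * w = u := by
    ext
    rw [Units.val_mul, hwn, hun, mul_add, Units.mul_inv, mul_one, add_comm]
  exact hcon.1 (eq_mul_inv_of_mul_eq h1 ▸ hS.mul_mem hu.1 hw.2)

theorem isCone [N.Normal] : IsCone N hS.unitSubgroup ((N : Set Dˣ) \ S) where
  le := fun _ h => hS.ssubset.1 h.1
  subset := Set.sdiff_subset
  neg_one_mem := ⟨hS.neg_one_mem, by rw [inv_neg, inv_one]; exact hS.neg_one_mem⟩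
  conj_mem := fun g c hc => ⟨Subgroup.Normal.conj_mem ‹_› c hc.1 g, fun h =>
    hc.2 (by simpa [mul_assoc] using hS.conj_mem g⁻¹ h)⟩
  mul_mem := fun c hc d hd => ⟨N.mul_mem hc.1 hd.1, fun h =>
    hc.2 (by simpa using hS.mul_mem h ((hS.mem_or_inv_mem hd.1).resolve_left hd.2))⟩
  mul_mem_left := fun h hh c hc => by simpa using hS.inv_mul_mem_diff hh.2 hc
  one_notMem := fun h => h.2 hS.one_mem
  total := fun n hn => by
    by_cases h1 : n ∈ S
    · by_cases h2 : n⁻¹ ∈ S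
      · exact Or.inl ⟨h1, h2⟩
      · exact Or.inr (Or.inr ⟨N.inv_mem hn, h2⟩)
    · exact Or.inr (Or.inl ⟨hn, h1⟩)
  one_add := fun c hc => hS.one_add_mem hc

theorem mem_nonunitPart {m : Dˣ} : m ∈ nonunitPart S ↔ m⁻¹ ∈ (N : Set Dˣ) \ S := by
  constructor
  · exact fun h => ⟨N.inv_mem (hS.ssubset.1 h.1), fun h' => h.2 ⟨h.1, h'⟩⟩
  · intro h
    have := (hS.mem_or_inv_mem h.1).resolve_left h.2
    rw [inv_inv] at this
    exact ⟨this, fun h' => h.2 h'.2⟩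

end UHypothesis

/-! ### Description of R and I by the extended cone. -/

namespace UHypothesis

section Membership

variable {D : Type*} [DivisionRing D] {N : Subgroup Dˣ} {S : Set Dˣ} (hS : UHypothesis N S)
  [N.Normal] {H : Subgroup Dˣ} [H.Normal]
  (hUH : hS.unitSubgroup ≤ H) (hHU : ∀ h ∈ H, h ∈ N → h ∈ hS.unitSubgroup)
  (hsup : ∀ g : Dˣ, ∃ n ∈ N, ∃ h ∈ H, n * h = g)
  (hadd : ∀ k ∈ H, k ∉ N → ∀ b ∈ (N : Set Dˣ) \ S, ∃ m ∈ N, (m : D) = k + ((b⁻¹ : Dˣ) : D))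

instance normal_unitSubgroup : hS.unitSubgroup.Normal where
  conj_mem := fun n hn g => ⟨hS.conj_mem g hn.1, by
    have := hS.conj_mem g hn.2
    simpa [mul_assoc] using this⟩

omit [H.Normal] in
include hHU in
theorem exists_add_notMem [Finite (Dˣ ⧸ N)] {k : Dˣ} (hk : k ∈ H) :
    ∃ u ∈ unitPart S, u ∉ nbhd N (k : D) := by
  -- For k ∈ N the witness -k makes the sum zero. For k ∉ N, finiteness of G* puts a power of k in H
  -- ∩ N = U.
  by_cases hkN : k ∈ N
  · refine ⟨-k, hS.isCone.neg_mem (hHU k hk hkN), ?_⟩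
    rintro ⟨-, m, -, hm⟩
    exact m.ne_zero (by rw [hm]; simp)
  · have hpow : k ^ (orderOf (k : Dˣ ⧸ N) - 1 + 1) ∈ hS.unitSubgroup := by
      rw [Nat.sub_add_cancel (orderOf_pos _)]
      refine hHU _ (H.pow_mem hk _) ((QuotientGroup.eq_one_iff _).1 ?_)
      rw [QuotientGroup.mk_pow, pow_orderOf_eq_one]
    obtain ⟨u, hu, huk⟩ := hS.isCone.exists_add_notMem hkN hpow
    exact ⟨u, hu, fun h => by
      obtain ⟨-, m, hm, hmk⟩ := h
      exact huk m hm hmk⟩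

include hUH hHU hsup hadd

theorem add_mem_of_mem_cone {c u : Dˣ} (hc : c ∈ ((N : Set Dˣ) \ S) * (H : Set Dˣ))
    (hu : u ∈ hS.unitSubgroup) : ∃ v ∈ hS.unitSubgroup, (v : D) = c + u := by
  have hC := hS.isCone.extend hUH hHU hsup hadd
  obtain ⟨b, hb, h, hh, hbh⟩ := hC.mul_mem_left _ (H.inv_mem (hUH hu)) _ hc
  obtain ⟨v, hv, hvv⟩ := hS.isCone.one_add_mul_mem hHU hadd hb hh
  refine ⟨u * v, hS.unitSubgroup.mul_mem hu hv, ?_⟩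
  rw [Units.val_mul, hvv, show b * h = u⁻¹ * c from hbh, mul_add, mul_one, Units.val_mul,
    Units.mul_inv_cancel_left, add_comm]

variable [Finite (Dˣ ⧸ N)]

theorem nonunitPart_subset_nbhd_iff {g : Dˣ} : nonunitPart S ⊆ nbhd N (g : D) ↔
    g ∈ (H : Set Dˣ) ∪ ((N : Set Dˣ) \ S) * (H : Set Dˣ) := by
  have hC := hS.isCone.extend hUH hHU hsup hadd
  constructor
  · intro h
    rcases hC.total g trivial with hg | hg | ⟨b, hb, k, hk, hbk⟩
    · exact Or.inl hg
    · exact Or.inr hg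
    · exfalso
      have hgk : g = k⁻¹ * b⁻¹ := by rw [← mul_inv_rev, show b * k = g⁻¹ from hbk, inv_inv]
      -- The element u b⁻¹ of M is a counterexample, since g + u b⁻¹ = (k⁻¹ + u) b⁻¹.
      obtain ⟨u, hu, huk⟩ := hS.exists_add_notMem hHU (H.inv_mem hk)
      have hm : u * b⁻¹ ∈ nonunitPart S := by
        rw [hS.mem_nonunitPart, mul_inv_rev, inv_inv]
        exact hS.isCone.mul_mem_right hb (hS.unitSubgroup.inv_mem hu)
      obtain ⟨-, n, hn, hnv⟩ := h hm
      refine huk ⟨hS.ssubset.1 hu.1, n * b, N.mul_mem hn hb.1, ?_⟩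
      rw [Units.val_mul, hnv, hgk]
      simp [add_mul]
  · intro hg m hm
    have hb := hS.mem_nonunitPart.1 hm
    have hbC : m⁻¹ ∈ ((N : Set Dˣ) \ S) * (H : Set Dˣ) := ⟨_, hb, 1, H.one_mem, mul_one _⟩
    obtain ⟨v, hv, hvv⟩ := hS.add_mem_of_mem_cone hUH hHU hsup hadd (hC.pos_mul hbC hg)
      hS.unitSubgroup.one_mem
    refine ⟨hS.ssubset.1 hm.1, m * v, N.mul_mem (hS.ssubset.1 hm.1) (hS.ssubset.1 hv.1), ?_⟩
    rw [Units.val_mul, hvv]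
    simp [mul_add]

theorem mem_ringSet_iff {x : D} : x ∈ ringSet N S ↔
    x = 0 ∨ ∃ g ∈ (H : Set Dˣ) ∪ ((N : Set Dˣ) \ S) * (H : Set Dˣ), (g : D) = x := by
  rcases eq_or_ne x 0 with rfl | hx
  · exact iff_of_true (Or.inl rfl) (Or.inl rfl)
  · refine or_congr_right ?_
    have := hS.nonunitPart_subset_nbhd_iff hUH hHU hsup hadd (g := Units.mk0 x hx)
    rw [Units.val_mk0] at this
    rw [this]
    constructor
    · exact fun h => ⟨_, h, rfl⟩
    · rintro ⟨g, hg, rfl⟩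
      simpa using hg

theorem mem_idealSet_iff {x : D} : x ∈ idealSet N S ↔
    x = 0 ∨ ∃ g ∈ ((N : Set Dˣ) \ S) * (H : Set Dˣ), (g : D) = x := by
  rw [idealSet, Set.mem_ofPred_eq, hS.mem_ringSet_iff hUH hHU hsup hadd]
  constructor
  · rintro ⟨rfl | ⟨g, hg | hg, rfl⟩, h⟩
    · exact Or.inl rfl
    · obtain ⟨u, hu, huk⟩ := hS.exists_add_notMem hHU hg
      exact (huk (h.resolve_left g.ne_zero hu)).elim
    · exact Or.inr ⟨g, hg, rfl⟩
  · rintro (rfl | ⟨g, hg, rfl⟩)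
    · exact ⟨Or.inl rfl, Or.inl rfl⟩
    · refine ⟨Or.inr ⟨g, Or.inr hg, rfl⟩, Or.inr fun u hu => ?_⟩
      obtain ⟨v, hv, hvv⟩ := hS.add_mem_of_mem_cone hUH hHU hsup hadd hg hu
      exact ⟨hS.ssubset.1 hu.1, v, hS.ssubset.1 hv.1, hvv⟩

end Membership

end UHypothesis

/-! ### The subgroup OU: it covers G modulo N and meets N in U. -/

section NormOne

variable {F D : Type*} [Field F] [DivisionRing D] [Algebra F D] [Algebra.IsCentral F D]
  [FiniteDimensional F D]

instance normal_normOne : (normOne F D).Normal := by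
  unfold normOne
  infer_instance

theorem exists_mul_normOne_of_commutator_eq_top {N : Subgroup Dˣ} [N.Normal]
    (hperf : commutator (Dˣ ⧸ N) = ⊤) (g : Dˣ) : ∃ n ∈ N, ∃ a ∈ normOne F D, n * a = g := by
  have hle : commutator (Dˣ ⧸ N) ≤ (normOne F D).map (QuotientGroup.mk' N) := by
    rw [commutator_def, Subgroup.commutator_le]
    intro a _ b _
    obtain ⟨a, rfl⟩ := QuotientGroup.mk'_surjective N a
    obtain ⟨b, rfl⟩ := QuotientGroup.mk'_surjective N b
    refine ⟨a * b * a⁻¹ * b⁻¹, ?_, by simp [commutatorElement_def]⟩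
    change Units.map (reducedNorm F D : D →* AlgebraicClosure F) (a * b * a⁻¹ * b⁻¹) = 1
    simp only [map_mul, map_inv, mul_inv_cancel_comm, mul_inv_cancel]
  obtain ⟨a, ha, hag⟩ := hle (hperf ▸ trivial : QuotientGroup.mk' N g ∈ _)
  refine ⟨g * a⁻¹, ?_, a, ha, by simp⟩
  rw [← QuotientGroup.ker_mk' N, MonoidHom.mem_ker, map_mul, map_inv, hag, mul_inv_cancel]

namespace UHypothesis

variable {N : Subgroup Dˣ} [N.Normal] {S : Set Dˣ} (hS : UHypothesis N S)

omit [N.Normal] in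
theorem coe_normOne_sup_unitSubgroup :
    ((normOne F D ⊔ hS.unitSubgroup : Subgroup Dˣ) : Set Dˣ) = normOneMul F S :=
  Subgroup.mul_normal (normOne F D) hS.unitSubgroup

/-- Neither a nor a⁻¹ can lie in the invariant semigroup N \ S, so trichotomy leaves only U. -/
theorem mem_unitSubgroup_of_mem_normOne {a : Dˣ} (ha : a ∈ normOne F D) (haN : a ∈ N) :
    a ∈ hS.unitSubgroup := by
  have hB := hS.isCone
  have key : ∀ a ∈ normOne F D, a ∉ (N : Set Dˣ) \ S := fun a ha =>
    notMem_of_mem_normOne hB.mul_mem (fun _ => hB.neg_mem_cone) hB.conj_mem hB.one_notMem ha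
  rcases hB.total a haN with h | h | h
  · exact h
  · exact (key a ha h).elim
  · exact (key _ (inv_mem ha) h).elim

theorem mem_unitSubgroup_of_mem_sup {a : Dˣ} (ha : a ∈ normOne F D ⊔ hS.unitSubgroup)
    (haN : a ∈ N) : a ∈ hS.unitSubgroup := by
  obtain ⟨o, ho, u, hu, rfl⟩ := Subgroup.mem_sup_of_normal_right.1 ha
  exact hS.unitSubgroup.mul_mem (hS.mem_unitSubgroup_of_mem_normOne ho
    ((N.mul_mem_cancel_right (hS.isCone.le hu)).1 haN)) hu

end UHypothesis

end NormOne

/-! ### The residue division ring and the main theorem. -/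

theorem infinite_of_surjective_units_of_commutator_eq_top {A G : Type*} [DivisionRing A] [Group G]
    [Nontrivial G] (hperf : commutator G = ⊤) (π : Aˣ →* G) (hπ : Function.Surjective π) :
    Infinite A := by
  by_contra hfin
  rw [not_infinite_iff_finite] at hfin
  have hcomm : ∀ a b : G, a * b = b * a := by
    intro a b
    obtain ⟨a, rfl⟩ := hπ a
    obtain ⟨b, rfl⟩ := hπ b
    rw [← map_mul, ← map_mul]
    exact congrArg π (Units.ext ((littleWedderburn A).mul_comm a b))
  have hbot : commutator G = ⊥ := by
    rw [commutator_def, Subgroup.commutator_eq_bot_iff_le_centralizer]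
    exact fun a _ b _ => hcomm b a
  exact bot_ne_top (hbot.symm.trans hperf)

theorem mainTheorem7 {F D : Type*} [Field F] [DivisionRing D] [Algebra F D]
    [Algebra.IsCentral F D] [FiniteDimensional F D]
    (N : Subgroup Dˣ) [N.Normal] [Finite (Dˣ ⧸ N)]
    (hFN : ∀ c : Fˣ, Units.map (algebraMap F D : F →* D) c ∈ N)
    (hperf : commutator (Dˣ ⧸ N) = ⊤)
    (S : Set Dˣ) (hS : UHypothesis N S)
    (hK : kHat F N S = normOneMul F S \ (N : Set Dˣ)) :
    ∃ R : Subring D, (R : Set D) = ringSet N S ∧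
      -- the two parts of `R`
      (R : Set D) ∩ Units.val '' (N : Set Dˣ) =
        Units.val '' (unitPart S ∪ ((N : Set Dˣ) \ S)) ∧
      (R : Set D) ∩ Units.val '' ((N : Set Dˣ)ᶜ) =
        Units.val '' ((unitPart S ∪ ((N : Set Dˣ) \ S)) * kHat F N S) ∧
      -- `R` is local, and `R \ I` is `OU`, which is the group of units of `R`
      IsLocalRing R ∧
      (R : Set D) \ idealSet N S = Units.val '' normOneMul F S ∧
      {x : D | ∃ u : Rˣ, ((u : R) : D) = x} = Units.val '' normOneMul F S ∧
      ∃ (I : Ideal R) (_ : I.IsTwoSided),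
        (Subtype.val '' (I : Set R) : Set D) = idealSet N S ∧
        -- `I` is the unique maximal ideal: left, right and two-sided
        (∀ J : Ideal R, J.IsMaximal ↔ J = I) ∧
        (∀ J : Submodule Rᵐᵒᵖ R, IsCoatom J ↔ (J : Set R) = I) ∧
        (∀ J : TwoSidedIdeal R, IsCoatom J ↔ (J : Set R) = I) ∧
        -- `R ⧸ I` is a division ring
        Nontrivial (R ⧸ I) ∧ (∀ q : R ⧸ I, q ≠ 0 → IsUnit q) ∧
        -- the map induced on unit groups is onto, with kernel inside `U`
        Function.Surjective (Units.map (Ideal.Quotient.mk I : R →* R ⧸ I)) ∧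
        (∀ r : Rˣ, Units.map (Ideal.Quotient.mk I : R →* R ⧸ I) r = 1 →
          Units.map (R.subtype : R →* D) r ∈ unitPart S) ∧
        -- the unit group of `R ⧸ I` maps onto `G*`, compatibly with `OU → G*`
        (∃ π : (R ⧸ I)ˣ →* Dˣ ⧸ N, Function.Surjective π ∧
          ∀ r : Rˣ, π (Units.map (Ideal.Quotient.mk I : R →* R ⧸ I) r) =
            (Units.map (R.subtype : R →* D) r : Dˣ ⧸ N)) ∧
        (Nontrivial (Dˣ ⧸ N) → Infinite (R ⧸ I)) ∧
        -- the final contradiction: `S` is not attached to a nontrivial class of `G*`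
        (∀ x : Dˣ ⧸ N, x ≠ 1 → S ≠ nSetClass N x) := by
  have hB := hS.isCone
  set H : Subgroup Dˣ := normOne F D ⊔ hS.unitSubgroup with hH
  have hcoe : (H : Set Dˣ) = normOneMul F S := hS.coe_normOne_sup_unitSubgroup
  have hUH : hS.unitSubgroup ≤ H := le_sup_right
  have hHU : ∀ h ∈ H, h ∈ N → h ∈ hS.unitSubgroup := fun h hh => hS.mem_unitSubgroup_of_mem_sup hh
  have hsup : ∀ g : Dˣ, ∃ n ∈ N, ∃ h ∈ H, n * h = g := by
    intro g
    obtain ⟨n, hn, a, ha, h⟩ := exists_mul_normOne_of_commutator_eq_top (F := F) hperf g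
    exact ⟨n, hn, a, le_sup_left (a := normOne F D) ha, h⟩
  have hker : ∀ k, k ∈ kHat F N S ↔ k ∈ H ∧ k ∉ N := by
    intro k
    rw [hK, ← hcoe]
    rfl
  -- The assumption on K̂, rewritten through M = (N \ S)⁻¹.
  have hadd : ∀ k ∈ H, k ∉ N → ∀ b ∈ (N : Set Dˣ) \ S,
      ∃ m ∈ N, (m : D) = k + ((b⁻¹ : Dˣ) : D) := by
    intro k hk hkN b hb
    exact (((hker k).2 ⟨hk, hkN⟩).2 (hS.mem_nonunitPart.2 (by rwa [inv_inv]))).2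
  have hC := hB.extend hUH hHU hsup hadd
  have hR : ∀ {x : D}, x ∈ ringSet N S ↔ x ∈ hC.subring := fun {x} =>
    hS.mem_ringSet_iff hUH hHU hsup hadd
  have hI := fun x : D => hS.mem_idealSet_iff hUH hHU hsup hadd (x := x)
  have hmk : ∀ {k : Dˣ}, (k : Dˣ ⧸ N) = 1 ↔ k ∈ N := QuotientGroup.eq_one_iff _
  have hunit : ∀ r : (hC.subring)ˣ, Units.map (hC.subring.subtype : hC.subring →* D) r ∈ H := by
    intro r
    obtain ⟨h, hh, hhr⟩ := hC.isUnit_iff.1 r.isUnit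
    have : Units.map (hC.subring.subtype : hC.subring →* D) r = h := Units.ext hhr.symm
    exact this ▸ hh
  have hlift : ∀ h ∈ H, ∃ r : (hC.subring)ˣ,
      Units.map (hC.subring.subtype : hC.subring →* D) r = h := by
    intro h hh
    obtain ⟨r, hr⟩ := (hC.isUnit_iff (r := ⟨h, Or.inr ⟨h, Or.inl hh, rfl⟩⟩)).2 ⟨h, hh, rfl⟩
    exact ⟨r, Units.ext (congrArg Subtype.val hr)⟩
  have hadd_unit : ∀ u ∈ unitPart S, ∀ i : hC.subring, i ∈ hC.ideal →
      ∃ v ∈ unitPart S, (v : D) = i + u := by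
    intro u hu i hi
    rcases hC.mem_ideal_iff.1 hi with h | ⟨c, hc, h⟩
    · exact ⟨u, hu, by rw [h, zero_add]⟩
    · rw [← h]
      exact hS.add_mem_of_mem_cone hUH hHU hsup hadd hc hu
  have := hC.isTwoSided_ideal
  have := hC.nontrivial_quotient
  -- The kernel is 1 + I, and I + U ⊆ U.
  have hkerU : ∀ r : (hC.subring)ˣ,
      Units.map (Ideal.Quotient.mk hC.ideal : hC.subring →* hC.subring ⧸ hC.ideal) r = 1 →
        Units.map (hC.subring.subtype : hC.subring →* D) r ∈ unitPart S := by
    intro r hr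
    have h1 : (r : hC.subring) - 1 ∈ hC.ideal := by
      rw [← Ideal.Quotient.eq_zero_iff_mem, map_sub, map_one, sub_eq_zero]
      exact congrArg Units.val hr
    obtain ⟨v, hv, hvr⟩ := hadd_unit 1 hS.unitSubgroup.one_mem _ h1
    have : Units.map (hC.subring.subtype : hC.subring →* D) r = v := by
      ext
      rw [hvr]
      simp
    exact this ▸ hv
  let φ : (hC.subring)ˣ →* Dˣ ⧸ N :=
    (QuotientGroup.mk' N).comp (Units.map (hC.subring.subtype : hC.subring →* D))
  let π : (hC.subring ⧸ hC.ideal)ˣ →* Dˣ ⧸ N :=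
    MonoidHom.liftOfSurjective _ hC.units_map_surjective ⟨φ, fun r hr =>
      hmk.2 (hB.le (hkerU r hr))⟩
  have hπ : ∀ r : (hC.subring)ˣ,
      π (Units.map (Ideal.Quotient.mk hC.ideal : hC.subring →* hC.subring ⧸ hC.ideal) r) =
        (Units.map (hC.subring.subtype : hC.subring →* D) r : Dˣ ⧸ N) := fun r =>
    MonoidHom.liftOfRightInverse_comp_apply _ _ _ _ r
  have hπs : Function.Surjective π := by
    intro q
    obtain ⟨g, rfl⟩ := QuotientGroup.mk_surjective q
    obtain ⟨n, hn, h, hh, rfl⟩ := hsup g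
    obtain ⟨r, rfl⟩ := hlift h hh
    refine ⟨_, (hπ r).trans ?_⟩
    rw [QuotientGroup.mk_mul, hmk.2 hn, one_mul]
  let _ : DivisionRing (hC.subring ⧸ hC.ideal) :=
    DivisionRing.ofIsUnitOrEqZero fun q => or_iff_not_imp_right.2 hC.isUnit_of_quotient_ne_zero
  have hinf : Nontrivial (Dˣ ⧸ N) → Infinite (hC.subring ⧸ hC.ideal) := fun _ =>
    infinite_of_surjective_units_of_commutator_eq_top hperf π hπs
  refine ⟨hC.subring, Set.ext fun x => hR.symm, ?_, ?_, hC.isLocalRing, ?_, ?_, hC.ideal,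
    hC.isTwoSided_ideal, ?_, hC.isMaximal_iff, hC.isCoatom_right_iff, hC.isCoatom_twoSided_iff,
    hC.nontrivial_quotient, fun q hq => hC.isUnit_of_quotient_ne_zero hq, hC.units_map_surjective,
    hkerU, ⟨π, hπs, hπ⟩, hinf, ?_⟩
  · ext x
    constructor
    · rintro ⟨hx, g, hg, rfl⟩
      obtain ⟨g', hg', hgg⟩ := (hC.mem_subring.1 hx).resolve_left g.ne_zero
      obtain rfl := Units.ext hgg
      refine ⟨g', ?_, rfl⟩
      rcases hg' with hg' | ⟨b, hb, h, hh, rfl⟩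
      · exact Or.inl (hHU _ hg' hg)
      · exact Or.inr (hB.mul_mem_right hb (hHU h hh ((N.mul_mem_cancel_left hb.1).1 hg)))
    · rintro ⟨g, hg | hg, rfl⟩
      · exact ⟨Or.inr ⟨g, Or.inl (hUH hg), rfl⟩, g, hB.le hg, rfl⟩
      · exact ⟨Or.inr ⟨g, Or.inr ⟨g, hg, 1, H.one_mem, mul_one g⟩, rfl⟩, g, hg.1, rfl⟩
  · ext x
    constructor
    · rintro ⟨hx, g, hg, rfl⟩
      obtain ⟨g', hg', hgg⟩ := (hC.mem_subring.1 hx).resolve_left g.ne_zero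
      obtain rfl := Units.ext hgg
      refine ⟨g', ?_, rfl⟩
      rcases hg' with hg' | ⟨b, hb, h, hh, rfl⟩
      · exact ⟨1, Or.inl hS.unitSubgroup.one_mem, g', (hker g').2 ⟨hg', hg⟩, one_mul _⟩
      · exact ⟨b, Or.inr hb, h, (hker h).2 ⟨hh, fun h' => hg (N.mul_mem hb.1 h')⟩, rfl⟩
    · rintro ⟨_, ⟨a, ha, k, hk, rfl⟩, rfl⟩
      obtain ⟨hkH, hkN⟩ := (hker k).1 hk
      rcases ha with ha | ha
      · exact ⟨Or.inr ⟨_, Or.inl (H.mul_mem (hUH ha) hkH), rfl⟩, _,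
          fun h => hkN ((N.mul_mem_cancel_left (hB.le ha)).1 h), rfl⟩
      · exact ⟨Or.inr ⟨_, Or.inr ⟨a, ha, k, hkH, rfl⟩, rfl⟩, _,
          fun h => hkN ((N.mul_mem_cancel_left ha.1).1 h), rfl⟩
  · rw [← hcoe]
    ext x
    constructor
    · rintro ⟨hx, hxI⟩
      rcases hC.mem_subring.1 hx with h | ⟨g, hg | hg, rfl⟩
      · exact (hxI ((hI x).2 (Or.inl h))).elim
      · exact ⟨g, hg, rfl⟩
      · exact (hxI ((hI _).2 (Or.inr ⟨g, hg, rfl⟩))).elim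
    · rintro ⟨g, hg, rfl⟩
      refine ⟨Or.inr ⟨g, Or.inl hg, rfl⟩, fun h => ?_⟩
      obtain ⟨c, hc, hcg⟩ := ((hI _).1 h).resolve_left g.ne_zero
      exact hC.notMem hg (Units.ext hcg ▸ hc)
  · rw [← hcoe]
    ext x
    constructor
    · rintro ⟨u, rfl⟩
      exact ⟨_, hunit u, rfl⟩
    · rintro ⟨g, hg, rfl⟩
      obtain ⟨r, rfl⟩ := hlift g hg
      exact ⟨r, rfl⟩
  · ext x
    rw [hI]
    constructor
    · rintro ⟨r, hr, rfl⟩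
      exact hC.mem_ideal_iff.1 hr
    · intro hx
      have hxR : x ∈ hC.subring := hx.imp_right fun ⟨g, hg, hgx⟩ => ⟨g, Or.inr hg, hgx⟩
      exact ⟨⟨x, hxR⟩, hC.mem_ideal_iff.2 hx, rfl⟩
  · rintro x hx hSx
    have := hinf ⟨x, 1, hx⟩
    obtain ⟨u, v, w, hu, hv, hw, huvw⟩ := exists_sub_eq_of_finite π hπs x
    obtain ⟨u, rfl⟩ := hC.units_map_surjective u
    obtain ⟨v, rfl⟩ := hC.units_map_surjective v
    obtain ⟨w, rfl⟩ := hC.units_map_surjective w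
    rw [hπ] at hu hv hw
    have huU := hHU _ (hunit u) (hmk.1 hu)
    have hvU := hHU _ (hunit v) (hmk.1 hv)
    have hwH := hunit w
    -- In R/I the relation is u = v + w, so w + v differs from u ∈ U by an element of I and lies in
    -- U.
    have hi : (w : hC.subring) + v - u ∈ hC.ideal := by
      rw [← Ideal.Quotient.eq_zero_iff_mem, map_sub, map_add, sub_eq_zero]
      exact (sub_eq_iff_eq_add.1 huvw).symm
    obtain ⟨t, ht, htv⟩ := hadd_unit _ huU _ hi
    set v' := Units.map (hC.subring.subtype : hC.subring →* D) v with hv'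
    set w' := Units.map (hC.subring.subtype : hC.subring →* D) w with hw'
    have htvw : (t : D) = w' + v' := by
      rw [htv]
      simp [hv', hw']
    -- Dividing w + v = t by v gives a = v⁻¹w with 1 + a = v⁻¹t ∈ N.
    have haP : v'⁻¹ * w' ∈ pSet N x := by
      refine ⟨?_, N.one_mem, v'⁻¹ * t, N.mul_mem (N.inv_mem (hB.le hvU)) (hB.le ht), ?_⟩
      · rw [QuotientGroup.mk_mul, hw, hmk.2 (N.inv_mem (hB.le hvU)), one_mul]
      · rw [Units.val_mul, htvw]
        simp [mul_add]
    have haH : v'⁻¹ * w' ∈ H := H.mul_mem (H.inv_mem (hUH hvU)) hwH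
    obtain ⟨n, hn, hna⟩ := hS.exists_add_notMem hHU haH
    refine hna ?_
    have hnx := hn.1
    rw [hSx] at hnx
    exact (hnx x (IsConj.refl x)).2 _ haP
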